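/- For real numbers $\alpha,\beta,\gamma$ with $\gamma\notin\{0,-1,-2,\dots\}$ and $|z|<1$, let $$F(\alpha,\beta;\gamma;z)=\sum_{n=0}^{\infty}\frac{(\alpha,n)(\beta,n)}{(\gamma,n)}\frac{z^n}{n!},\qquad (\alpha,0)=1,\quad (\alpha,n)=\alpha(\alpha+1)\cdots(\alpha+n-1)\ \ (n\ge 1),$$ be the Gaussian hypergeometric function, and let $\Gamma$ be Euler's gamma function. **Theorem (Elliott's identity).** Let $a,b,c\ge 0$ be real numbers and let $0<x<1$. Put \begin{align*} F_1&=F\left(\tfrac12+a,\,-\tfrac12-c;\,1+a+b;\,x\right),\\ F_2&=F\left(\tfrac12-a,\,\tfrac12+c;\,1+b+c;\,1-x\right),\\ F_3&=F\left(\tfrac12+a,\,\tfrac12-c;\,1+a+b;\,x\right),\\ F_4&=F\left(-\tfrac12-a,\,\tfrac12+c;\,1+b+c;\,1-x\right). \end{align*} Then $$F_1F_2+F_3F_4-F_2F_3=\frac{\Gamma(a+b+1)\,\Gamma(b+c+1)}{\Gamma\left(a+b+c+\tfrac32\right)\Gamma\left(b+\tfrac12\right)}.$$ -/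

import Mathlib

/-! The left side is constant on `(0, 1)`, and its value is found by letting `x → 0+`. Contiguous
relations express the derivatives of `F₁`, `F₃` through `F₁`, `F₃`, and those of `F₂`, `F₄` through
`F₂`, `F₄`; substituted into the product rule, everything cancels (`hasDerivAt_elliott`). For the
limit, write the left side as `(F₁ - F₃) F₂ + F₃ F₄`. Here `F₁ - F₃ = O(x)` and `x F₂ → 0`, while
`F₃ → 1` and `F₄` tends to Gauss's value at `1`. Both limits at argument `1` come from Euler's
integral by dominated convergence. -/

/-! ### Power series and contiguous relations. -/

theorem ordinaryHypergeometric_symm (α β γ : ℝ) :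
    (₂F₁ α β γ : ℝ → ℝ) = ₂F₁ β α γ := by
  funext x
  rw [ordinaryHypergeometric, ordinaryHypergeometric, ordinaryHypergeometricSeries_symm]

/-- If the bottom parameter is positive, the hypergeometric series converges on the unit disc. -/
theorem one_le_radius_ordinaryHypergeometricSeries (α β : ℝ) {γ : ℝ} (hγ : 0 < γ) :
    1 ≤ (ordinaryHypergeometricSeries ℝ α β γ).radius := by
  by_cases h : ∀ k : ℕ, (k : ℝ) ≠ -α ∧ (k : ℝ) ≠ -β
  · refine (ordinaryHypergeometricSeries_radius_eq_one ℝ α β γ fun k => ?_).ge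
    refine ⟨(h k).1, (h k).2, ?_⟩
    have : (0 : ℝ) ≤ k := k.cast_nonneg
    linarith
  · push Not at h
    obtain ⟨k, hk⟩ := h
    by_cases h1 : (k : ℝ) = -α
    · rw [show α = -(k : ℝ) by linarith, ordinaryHypergeometric_radius_top_of_neg_nat₁]
      exact le_top
    · rw [show β = -(k : ℝ) by linarith [hk h1], ordinaryHypergeometric_radius_top_of_neg_nat₂]
      exact le_top

theorem enorm_lt_radius_ordinaryHypergeometricSeries (α β : ℝ) {γ x : ℝ} (hγ : 0 < γ)
    (hx : |x| < 1) : ‖x‖ₑ < (ordinaryHypergeometricSeries ℝ α β γ).radius := by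
  refine lt_of_lt_of_le ?_ (one_le_radius_ordinaryHypergeometricSeries α β hγ)
  rw [← ofReal_norm, Real.norm_eq_abs]
  simpa using (ENNReal.ofReal_lt_ofReal_iff one_pos).2 hx

theorem summable_norm_ordinaryHypergeometric (α β : ℝ) {γ x : ℝ} (hγ : 0 < γ) (hx : |x| < 1) :
    Summable fun n => ‖ordinaryHypergeometricCoefficient α β γ n * x ^ n‖ := by
  have := (ordinaryHypergeometricSeries ℝ α β γ).summable_norm_apply (x := x)
    (by simpa using enorm_lt_radius_ordinaryHypergeometricSeries α β hγ hx)
  simpa only [ordinaryHypergeometricSeries_apply_eq, smul_eq_mul] using this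

theorem hasSum_ordinaryHypergeometric (α β : ℝ) {γ x : ℝ} (hγ : 0 < γ) (hx : |x| < 1) :
    HasSum (fun n => ordinaryHypergeometricCoefficient α β γ n * x ^ n) (₂F₁ α β γ x) := by
  rw [ordinaryHypergeometric_eq_tsum]
  exact (summable_norm_ordinaryHypergeometric α β hγ hx).of_norm.hasSum

theorem hasSum_mul_deriv_ordinaryHypergeometric (α β : ℝ) {γ x : ℝ} (hγ : 0 < γ) (hx : |x| < 1) :
    HasSum (fun n : ℕ => n * ordinaryHypergeometricCoefficient α β γ n * x ^ n)
      (x * deriv (₂F₁ α β γ) x) := by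
  set p := ordinaryHypergeometricSeries ℝ α β γ with hp
  have hr := enorm_lt_radius_ordinaryHypergeometricSeries α β hγ hx
  have hd : HasFDerivAt (₂F₁ α β γ) (p.derivSeries.sum x) x := p.hasFDerivAt_sum hr
  have hs : HasSum (fun n => p.derivSeries n fun _ => x) (p.derivSeries.sum x) :=
    p.derivSeries.hasSum (by simpa using hr.trans_le p.radius_le_radius_derivSeries)
  have hs' := (ContinuousLinearMap.apply ℝ ℝ x).hasSum hs
  simp only [ContinuousLinearMap.apply_apply,
    FormalMultilinearSeries.derivSeries_apply_diag] at hs'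
  have hv : p.derivSeries.sum x x = x * deriv (₂F₁ α β γ) x := by
    rw [hd.hasDerivAt.deriv, ← smul_eq_mul, ← map_smul, smul_eq_mul, mul_one]
  rw [hv] at hs'
  -- The `n`-th term of `derivSeries` carries the coefficient of index `n + 1`; the missing term of
  -- index `0` vanishes.
  rw [← hasSum_nat_add_iff' 1]
  simpa [hp, ordinaryHypergeometricSeries_apply_eq, mul_assoc,
    -FormalMultilinearSeries.apply_eq_prod_smul_coeff] using hs'

theorem differentiableAt_ordinaryHypergeometric (α β : ℝ) {γ x : ℝ} (hγ : 0 < γ) (hx : |x| < 1) :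
    DifferentiableAt ℝ (₂F₁ α β γ) x :=
  (FormalMultilinearSeries.hasFDerivAt_sum
    (enorm_lt_radius_ordinaryHypergeometricSeries α β hγ hx)).differentiableAt

theorem ordinaryHypergeometricCoefficient_succ (α β : ℝ) {γ : ℝ} (hγ : 0 < γ) (n : ℕ) :
    ((n + 1) * (γ + n)) * ordinaryHypergeometricCoefficient α β γ (n + 1) =
      (α + n) * (β + n) * ordinaryHypergeometricCoefficient α β γ n := by
  have h1 : (γ + n) ≠ 0 := by positivity
  have h2 : (ascPochhammer ℝ n).eval γ ≠ 0 := (ascPochhammer_pos n γ hγ).ne'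
  have h3 : (n.factorial : ℝ) ≠ 0 := by positivity
  simp only [ordinaryHypergeometricCoefficient, ascPochhammer_succ_eval, Nat.factorial_succ]
  push_cast
  field_simp

/-- Both `(β - 1, n)(β - 1 + n)` and `(β - 1)(β, n)` equal `(β - 1, n + 1)`. -/
theorem ordinaryHypergeometricCoefficient_sub_one (α β γ : ℝ) (n : ℕ) :
    (β - 1 + n) * ordinaryHypergeometricCoefficient α (β - 1) γ n =
      (β - 1) * ordinaryHypergeometricCoefficient α β γ n := by
  have h : (ascPochhammer ℝ n).eval (β - 1) * (β - 1 + n) =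
      (β - 1) * (ascPochhammer ℝ n).eval β := by
    rw [← ascPochhammer_succ_eval, ascPochhammer_succ_left]
    simp
  simp only [ordinaryHypergeometricCoefficient]
  linear_combination (n.factorial : ℝ)⁻¹ * (ascPochhammer ℝ n).eval α *
    ((ascPochhammer ℝ n).eval γ)⁻¹ * h

theorem ordinaryHypergeometricCoefficient_succ_sub_one (α β : ℝ) {γ : ℝ} (hγ : 0 < γ) (n : ℕ) :
    ((n + 1) * (γ + n)) * ordinaryHypergeometricCoefficient α (β - 1) γ (n + 1) =
      (α + n) * (β - 1) * ordinaryHypergeometricCoefficient α β γ n := by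
  rw [ordinaryHypergeometricCoefficient_succ _ _ hγ]
  linear_combination (α + n) * ordinaryHypergeometricCoefficient_sub_one α β γ n

theorem mul_deriv_ordinaryHypergeometric_sub_one (α β : ℝ) {γ x : ℝ} (hγ : 0 < γ)
    (hx : |x| < 1) :
    x * deriv (₂F₁ α (β - 1) γ) x = (β - 1) * (₂F₁ α β γ x - ₂F₁ α (β - 1) γ x) := by
  refine (hasSum_mul_deriv_ordinaryHypergeometric α (β - 1) hγ hx).unique ?_
  refine (((hasSum_ordinaryHypergeometric α β hγ hx).sub
    (hasSum_ordinaryHypergeometric α (β - 1) hγ hx)).mul_left (β - 1)).congr_fun fun n => ?_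
  linear_combination x ^ n * ordinaryHypergeometricCoefficient_sub_one α β γ n

theorem mul_deriv_ordinaryHypergeometric (α β : ℝ) {γ x : ℝ} (hγ : 0 < γ) (hx : |x| < 1) :
    x * (1 - x) * deriv (₂F₁ α β γ) x =
      (γ - β) * ₂F₁ α (β - 1) γ x + (β - γ + α * x) * ₂F₁ α β γ x := by
  have h0 := hasSum_ordinaryHypergeometric α β hγ hx
  have h1 := hasSum_ordinaryHypergeometric α (β - 1) hγ hx
  have hd := hasSum_mul_deriv_ordinaryHypergeometric α β hγ hx
  -- The claim is rearranged as `(γ - β)(F - F⁻) + x F' = x (α F + x F')`, where `F⁻` has `β - 1`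
  -- for `β`. The left side has no constant term, so coefficients of `x ^ (n + 1)` are compared.
  have hl := ((h0.sub h1).mul_left (γ - β)).add hd
  have hr := ((h0.mul_left α).add hd).mul_left x
  rw [← hasSum_nat_add_iff' 1] at hl
  have := hl.unique (hr.congr_fun fun n => ?_)
  · simp [ordinaryHypergeometricCoefficient] at this
    linear_combination this
  · have hne : ((n : ℝ) + 1) * (γ + n) ≠ 0 := by positivity
    have e1 := ordinaryHypergeometricCoefficient_succ α β hγ n
    have e2 := ordinaryHypergeometricCoefficient_succ_sub_one α β hγ n
    apply mul_left_cancel₀ hne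
    push_cast
    rw [pow_succ]
    linear_combination (γ - β + n + 1) * x ^ n * x * e1 - (γ - β) * x ^ n * x * e2

/-! ### Beta integrals, Euler's integral and limits at argument 1. -/

open MeasureTheory Filter Topology Set ProbabilityTheory

theorem integrableOn_beta {u v : ℝ} (hu : 0 < u) (hv : 0 < v) :
    IntegrableOn (fun t : ℝ => t ^ (u - 1) * (1 - t) ^ (v - 1)) (Ioo 0 1) := by
  have h := Complex.betaIntegral_convergent (u := u) (v := v) (by simpa) (by simpa)
  rw [intervalIntegrable_iff_integrableOn_Ioo_of_le zero_le_one] at h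
  refine (integrableOn_congr_fun (fun t ht => ?_) measurableSet_Ioo).1 h.re
  have h0 := ht.1.le
  have h1 : 0 ≤ 1 - t := by linarith [ht.2]
  simp only [RCLike.re_to_complex]
  norm_cast
  rw [← Complex.ofReal_cpow h0, ← Complex.ofReal_cpow h1, ← Complex.ofReal_mul, Complex.ofReal_re]

theorem integral_beta {u v : ℝ} (hu : 0 < u) (hv : 0 < v) :
    ∫ t in Ioo (0 : ℝ) 1, t ^ (u - 1) * (1 - t) ^ (v - 1) = beta u v := by
  have h := Complex.betaIntegral_convergent (u := u) (v := v) (by simpa) (by simpa)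
  rw [intervalIntegrable_iff_integrableOn_Ioo_of_le zero_le_one] at h
  rw [beta_eq_betaIntegralReal u v hu hv, Complex.betaIntegral,
    intervalIntegral.integral_of_le zero_le_one, integral_Ioc_eq_integral_Ioo,
    ← RCLike.re_to_complex, ← integral_re h]
  refine setIntegral_congr_fun measurableSet_Ioo fun t ht => ?_
  have h0 := ht.1.le
  have h1 : 0 ≤ 1 - t := by linarith [ht.2]
  simp only [RCLike.re_to_complex]
  norm_cast
  rw [← Complex.ofReal_cpow h0, ← Complex.ofReal_cpow h1, ← Complex.ofReal_mul, Complex.ofReal_re]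

theorem Gamma_add_natCast {s : ℝ} (hs : 0 < s) (n : ℕ) :
    Real.Gamma (s + n) = (ascPochhammer ℝ n).eval s * Real.Gamma s := by
  induction n with
  | zero => simp
  | succ n ih =>
    rw [Nat.cast_succ, ← add_assoc, Real.Gamma_add_one (by positivity), ih,
      ascPochhammer_succ_eval]
    ring

theorem beta_add_natCast {u v : ℝ} (hu : 0 < u) (hv : 0 < v) (n : ℕ) :
    beta (u + n) v =
      beta u v * ((ascPochhammer ℝ n).eval u * ((ascPochhammer ℝ n).eval (u + v))⁻¹) := by
  rw [beta, beta, Gamma_add_natCast hu, add_right_comm, Gamma_add_natCast (add_pos hu hv)]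
  field_simp

theorem hasSum_one_sub_rpow_neg (α : ℝ) {y : ℝ} (hy : |y| < 1) :
    HasSum (fun n : ℕ => (n.factorial : ℝ)⁻¹ * (ascPochhammer ℝ n).eval α * y ^ n)
      ((1 - y) ^ (-α)) := by
  have h := (Real.one_add_rpow_hasFPowerSeriesOnBall_zero (a := -α)).hasSum (y := -y) (by
    simpa [← ofReal_norm] using hy)
  rw [binomialSeries_eq_ordinaryHypergeometricSeries (b := 1)
    (fun k => by have : (0 : ℝ) ≤ k := k.cast_nonneg
                 linarith)] at h
  simp only [zero_add, FormalMultilinearSeries.compContinuousLinearMap_apply] at h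
  rw [← sub_eq_add_neg] at h
  refine h.congr_fun fun n => ?_
  have h1 : (ascPochhammer ℝ n).eval 1 ≠ 0 := (ascPochhammer_pos n 1 one_pos).ne'
  have := ordinaryHypergeometricSeries_apply_eq (𝔸 := ℝ) α 1 1 y n
  simp only [smul_eq_mul] at this
  rw [mul_inv_cancel_right₀ h1] at this
  rw [← this, neg_neg]
  congr 1
  ext i
  simp

/-- **Euler's integral representation** of the hypergeometric function. -/
theorem integral_eq_beta_mul_ordinaryHypergeometric (α : ℝ) {β δ z : ℝ} (hβ : 0 < β) (hδ : 0 < δ)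
    (hz0 : 0 ≤ z) (hz1 : z < 1) :
    ∫ t in Ioo (0 : ℝ) 1, t ^ (β - 1) * (1 - t) ^ (δ - 1) * (1 - z * t) ^ (-α) =
      beta β δ * ₂F₁ α β (β + δ) z := by
  have hz : |z| < 1 := by rwa [abs_of_nonneg hz0]
  set c : ℕ → ℝ := fun n => (n.factorial : ℝ)⁻¹ * (ascPochhammer ℝ n).eval α * z ^ n with hc
  set g : ℕ → ℝ → ℝ := fun n t => c n * (t ^ (β + n - 1) * (1 - t) ^ (δ - 1)) with hg
  have hβn (n : ℕ) : 0 < β + n := by positivity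
  have hint (n : ℕ) : Integrable (g n) (volume.restrict (Ioo 0 1)) :=
    (integrableOn_beta (hβn n) hδ).const_mul _
  have hval (n : ℕ) : c n * beta (β + n) δ =
      beta β δ * (ordinaryHypergeometricCoefficient α β (β + δ) n * z ^ n) := by
    rw [beta_add_natCast hβ hδ]
    simp only [hc, ordinaryHypergeometricCoefficient]
    ring
  -- The beta kernel is nonnegative, so absolute convergence of the hypergeometric series is enough
  -- to swap sum and integral.
  have hnorm (n : ℕ) : ∫ t in Ioo (0 : ℝ) 1, ‖g n t‖ = ‖c n * beta (β + n) δ‖ := by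
    rw [norm_mul, Real.norm_of_nonneg (beta_pos (hβn n) hδ).le, ← integral_beta (hβn n) hδ,
      ← integral_const_mul]
    refine setIntegral_congr_fun measurableSet_Ioo fun t ht => ?_
    have h0 := ht.1.le
    have h1 : 0 ≤ 1 - t := by linarith [ht.2]
    simp only [hg, norm_mul]
    rw [Real.norm_of_nonneg (Real.rpow_nonneg h0 _), Real.norm_of_nonneg (Real.rpow_nonneg h1 _)]
  have hsum := hasSum_integral_of_summable_integral_norm hint (by
    simp only [hnorm, hval, norm_mul (beta β δ)]
    exact (summable_norm_ordinaryHypergeometric α β (add_pos hβ hδ) hz).mul_left _)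
  have hsum' := (hasSum_ordinaryHypergeometric α β (add_pos hβ hδ) hz).mul_left (beta β δ)
  have : ∫ t in Ioo (0 : ℝ) 1, ∑' n, g n t = beta β δ * ₂F₁ α β (β + δ) z := by
    refine hsum.unique (hsum'.congr_fun fun n => ?_)
    simp only [hg]
    rw [integral_const_mul, integral_beta (hβn n) hδ, hval]
  rw [← this]
  refine setIntegral_congr_fun measurableSet_Ioo fun t ht => ?_
  have hzt : |z * t| < 1 := by
    rw [abs_mul, abs_of_pos ht.1]
    nlinarith [abs_nonneg z, ht.1, ht.2]
  have hb := (hasSum_one_sub_rpow_neg α hzt).mul_left (t ^ (β - 1) * (1 - t) ^ (δ - 1))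
  refine (HasSum.tsum_eq (hb.congr_fun fun n => ?_)).symm
  simp only [hg, hc]
  rw [show β + n - 1 = β - 1 + n by ring, Real.rpow_add_natCast ht.1.ne']
  ring

/-- Gauss's evaluation at `1`, as a radial limit, for parameters `α ≤ 0 < β`. -/
theorem tendsto_ordinaryHypergeometric_one_sub {α β δ : ℝ} (hα : α ≤ 0) (hβ : 0 < β)
    (hδ : 0 < δ) :
    Tendsto (fun x : ℝ => ₂F₁ α β (β + δ) (1 - x)) (𝓝[>] 0) (𝓝 (beta β (δ - α) / beta β δ)) := by
  have hB := (beta_pos hβ hδ).ne'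
  have hlim : Tendsto (fun x : ℝ => ∫ t in Ioo (0 : ℝ) 1,
      t ^ (β - 1) * (1 - t) ^ (δ - 1) * (1 - (1 - x) * t) ^ (-α)) (𝓝[>] 0)
      (𝓝 (∫ t in Ioo (0 : ℝ) 1, t ^ (β - 1) * (1 - t) ^ (δ - 1) * (1 - (1 - 0) * t) ^ (-α))) := by
    refine tendsto_integral_filter_of_dominated_convergence _ ?_ ?_ (integrableOn_beta hβ hδ) ?_
    · exact .of_forall fun x => Measurable.aestronglyMeasurable (by fun_prop)
    · filter_upwards [Ioo_mem_nhdsGT (zero_lt_one' ℝ)] with x hx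
      refine ae_restrict_of_forall_mem measurableSet_Ioo fun t ht => ?_
      have h1 : 0 ≤ 1 - t := by linarith [ht.2]
      have h2 : 0 ≤ 1 - (1 - x) * t := by nlinarith [hx.1, hx.2, ht.1, ht.2]
      have h3 : 1 - (1 - x) * t ≤ 1 := by nlinarith [hx.1, hx.2, ht.1, ht.2]
      have h4 : 0 ≤ t ^ (β - 1) * (1 - t) ^ (δ - 1) :=
        mul_nonneg (Real.rpow_nonneg ht.1.le _) (Real.rpow_nonneg h1 _)
      rw [Real.norm_of_nonneg (mul_nonneg h4 (Real.rpow_nonneg h2 _))]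
      -- Since `-α ≥ 0`, the last factor is at most `1` and the beta kernel dominates.
      exact mul_le_of_le_one_right h4 (Real.rpow_le_one h2 h3 (by linarith))
    · refine ae_restrict_of_forall_mem measurableSet_Ioo fun t ht => ?_
      refine Tendsto.const_mul _ (Tendsto.rpow_const ?_ (Or.inr (by linarith)))
      exact (Continuous.tendsto (by fun_prop) 0).mono_left nhdsWithin_le_nhds
  have hval : ∫ t in Ioo (0 : ℝ) 1, t ^ (β - 1) * (1 - t) ^ (δ - 1) * (1 - (1 - 0) * t) ^ (-α) =
      beta β (δ - α) := by
    rw [← integral_beta hβ (by linarith)]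
    refine setIntegral_congr_fun measurableSet_Ioo fun t ht => ?_
    have h1 : 0 < 1 - t := by linarith [ht.2]
    simp only [sub_zero, one_mul]
    rw [mul_assoc, ← Real.rpow_add h1, show δ - 1 + -α = δ - α - 1 by ring]
  rw [hval] at hlim
  refine (hlim.div_const (beta β δ)).congr' ?_
  filter_upwards [Ioo_mem_nhdsGT (zero_lt_one' ℝ)] with x hx
  rw [integral_eq_beta_mul_ordinaryHypergeometric α hβ hδ (by linarith [hx.2])
    (by linarith [hx.1]), mul_div_cancel_left₀ _ hB]

/-- Needed for `F₂`, whose first parameter `1 / 2 - a` may be positive. With `w = 1 - (1 - x) t ≥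
x`, domination follows from `x w ^ (-α) ≤ w ^ (1 - α) ≤ 1`. -/
theorem tendsto_mul_ordinaryHypergeometric_one_sub {α β δ : ℝ} (hα : α < 1) (hβ : 0 < β)
    (hδ : 0 < δ) :
    Tendsto (fun x : ℝ => x * ₂F₁ α β (β + δ) (1 - x)) (𝓝[>] 0) (𝓝 0) := by
  have hB := (beta_pos hβ hδ).ne'
  have hlim : Tendsto (fun x : ℝ => ∫ t in Ioo (0 : ℝ) 1,
      t ^ (β - 1) * (1 - t) ^ (δ - 1) * (x * (1 - (1 - x) * t) ^ (-α))) (𝓝[>] 0)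
      (𝓝 (∫ t in Ioo (0 : ℝ) 1, t ^ (β - 1) * (1 - t) ^ (δ - 1) *
        (0 * (1 - (1 - 0) * t) ^ (-α)))) := by
    refine tendsto_integral_filter_of_dominated_convergence _ ?_ ?_ (integrableOn_beta hβ hδ) ?_
    · exact .of_forall fun x => Measurable.aestronglyMeasurable (by fun_prop)
    · filter_upwards [Ioo_mem_nhdsGT (zero_lt_one' ℝ)] with x hx
      refine ae_restrict_of_forall_mem measurableSet_Ioo fun t ht => ?_
      have h1 : 0 ≤ 1 - t := by linarith [ht.2]
      have h2 : x ≤ 1 - (1 - x) * t := by nlinarith [hx.1, hx.2, ht.1, ht.2]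
      have h2' : 0 < 1 - (1 - x) * t := hx.1.trans_le h2
      have h3 : 1 - (1 - x) * t ≤ 1 := by nlinarith [hx.1, hx.2, ht.1, ht.2]
      have h4 : 0 ≤ t ^ (β - 1) * (1 - t) ^ (δ - 1) :=
        mul_nonneg (Real.rpow_nonneg ht.1.le _) (Real.rpow_nonneg h1 _)
      have h5 := Real.rpow_nonneg h2'.le (-α)
      rw [Real.norm_of_nonneg (mul_nonneg h4 (mul_nonneg hx.1.le h5))]
      refine mul_le_of_le_one_right h4 ((mul_le_mul_of_nonneg_right h2 h5).trans ?_)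
      rw [← Real.rpow_one_add' h2'.le (by linarith)]
      exact Real.rpow_le_one h2'.le h3 (by linarith)
    · refine ae_restrict_of_forall_mem measurableSet_Ioo fun t ht => ?_
      refine Tendsto.const_mul _ (Tendsto.mul ?_ (Tendsto.rpow_const ?_ (Or.inl ?_)))
      · exact tendsto_id.mono_left nhdsWithin_le_nhds
      · exact (Continuous.tendsto (by fun_prop) 0).mono_left nhdsWithin_le_nhds
      · linarith [ht.2]
  simp only [zero_mul, mul_zero, integral_zero] at hlim
  have hlim' := hlim.div_const (beta β δ)
  rw [zero_div] at hlim'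
  refine hlim'.congr' ?_
  filter_upwards [Ioo_mem_nhdsGT (zero_lt_one' ℝ)] with x hx
  simp only [mul_left_comm _ x]
  rw [integral_const_mul, integral_eq_beta_mul_ordinaryHypergeometric α hβ hδ (by linarith [hx.2])
    (by linarith [hx.1]), mul_left_comm, mul_div_cancel_left₀ _ hB]

/-- The left-hand side of Elliott's identity has zero derivative. -/
theorem hasDerivAt_elliott {a b c x : ℝ} (hab : 0 < 1 + a + b) (hbc : 0 < 1 + b + c)
    (hx : x ∈ Ioo (0 : ℝ) 1) :
    HasDerivAt (fun x : ℝ =>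
      ₂F₁ (1 / 2 + a) (-1 / 2 - c) (1 + a + b) x * ₂F₁ (1 / 2 - a) (1 / 2 + c) (1 + b + c) (1 - x) +
      ₂F₁ (1 / 2 + a) (1 / 2 - c) (1 + a + b) x * ₂F₁ (-1 / 2 - a) (1 / 2 + c) (1 + b + c) (1 - x) -
      ₂F₁ (1 / 2 - a) (1 / 2 + c) (1 + b + c) (1 - x) * ₂F₁ (1 / 2 + a) (1 / 2 - c) (1 + a + b) x)
      0 x := by
  obtain ⟨hx0, hx1⟩ := hx
  have hx : |x| < 1 := by rw [abs_lt]; constructor <;> linarith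
  have hy : |1 - x| < 1 := by rw [abs_lt]; constructor <;> linarith
  have d1 := (differentiableAt_ordinaryHypergeometric (1 / 2 + a) (-1 / 2 - c) hab hx).hasDerivAt
  have d3 := (differentiableAt_ordinaryHypergeometric (1 / 2 + a) (1 / 2 - c) hab hx).hasDerivAt
  have d2 := (differentiableAt_ordinaryHypergeometric (1 / 2 - a) (1 / 2 + c) hbc
    hy).hasDerivAt.comp_const_sub 1 x
  have d4 := (differentiableAt_ordinaryHypergeometric (-1 / 2 - a) (1 / 2 + c) hbc
    hy).hasDerivAt.comp_const_sub 1 x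
  have e1 := mul_deriv_ordinaryHypergeometric_sub_one (1 / 2 + a) (1 / 2 - c) hab hx
  have e3 := mul_deriv_ordinaryHypergeometric (1 / 2 + a) (1 / 2 - c) hab hx
  have e4 := mul_deriv_ordinaryHypergeometric_sub_one (1 / 2 + c) (1 / 2 - a) hbc hy
  have e2 := mul_deriv_ordinaryHypergeometric (1 / 2 + c) (1 / 2 - a) hbc hy
  rw [show 1 / 2 - c - 1 = -1 / 2 - c by ring] at e1 e3
  rw [show 1 / 2 - a - 1 = -1 / 2 - a by ring, ordinaryHypergeometric_symm (1 / 2 + c),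
    ordinaryHypergeometric_symm (1 / 2 + c)] at e2 e4
  refine (((d1.mul d2).add (d3.mul d4)).sub (d2.mul d3)).congr_deriv ?_
  have hne : x * (1 - x) ≠ 0 := (mul_pos hx0 (by linarith)).ne'
  apply mul_left_cancel₀ hne
  generalize deriv (₂F₁ (1 / 2 + a) (-1 / 2 - c) (1 + a + b)) x = D1 at *
  generalize deriv (₂F₁ (1 / 2 + a) (1 / 2 - c) (1 + a + b)) x = D3 at *
  generalize deriv (₂F₁ (1 / 2 - a) (1 / 2 + c) (1 + b + c)) (1 - x) = D2 at *
  generalize deriv (₂F₁ (-1 / 2 - a) (1 / 2 + c) (1 + b + c)) (1 - x) = D4 at *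
  generalize ₂F₁ (1 / 2 + a) (-1 / 2 - c) (1 + a + b) x = f1 at *
  generalize ₂F₁ (1 / 2 + a) (1 / 2 - c) (1 + a + b) x = f3 at *
  generalize ₂F₁ (1 / 2 - a) (1 / 2 + c) (1 + b + c) (1 - x) = f2 at *
  generalize ₂F₁ (-1 / 2 - a) (1 / 2 + c) (1 + b + c) (1 - x) = f4 at *
  -- The weights are the coefficients of `D1`, `D3`, `D4`, `D2` in the product rule, scaled to match
  -- `x * (1 - x)`.
  linear_combination (1 - x) * f2 * e1 + (f4 - f2) * e3 - x * f3 * e4 + (f3 - f1) * e2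

theorem theorem5p2 (a b c : ℝ) (ha : 0 ≤ a) (hb : 0 ≤ b) (hc : 0 ≤ c)
    (x : ℝ) (hx0 : 0 < x) (hx1 : x < 1)
    (F₁ F₂ F₃ F₄ : ℝ)
    (hF₁ : F₁ = ₂F₁ (1 / 2 + a) (-1 / 2 - c) (1 + a + b) x)
    (hF₂ : F₂ = ₂F₁ (1 / 2 - a) (1 / 2 + c) (1 + b + c) (1 - x))
    (hF₃ : F₃ = ₂F₁ (1 / 2 + a) (1 / 2 - c) (1 + a + b) x)
    (hF₄ : F₄ = ₂F₁ (-1 / 2 - a) (1 / 2 + c) (1 + b + c) (1 - x)) :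
    F₁ * F₂ + F₃ * F₄ - F₂ * F₃ =
      Real.Gamma (a + b + 1) * Real.Gamma (b + c + 1) /
        (Real.Gamma (a + b + c + 3 / 2) * Real.Gamma (b + 1 / 2)) := by
  have hab : 0 < 1 + a + b := by linarith
  have hbc : 0 < 1 + b + c := by linarith
  have hβ : 0 < 1 / 2 + c := by linarith
  have hδ : 0 < 1 / 2 + b := by linarith
  have hγ : 1 / 2 + c + (1 / 2 + b) = 1 + b + c := by ring
  set f₁ : ℝ → ℝ := ₂F₁ (1 / 2 + a) (-1 / 2 - c) (1 + a + b) with hf₁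
  set f₃ : ℝ → ℝ := ₂F₁ (1 / 2 + a) (1 / 2 - c) (1 + a + b) with hf₃
  set f₂ : ℝ → ℝ := ₂F₁ (1 / 2 - a) (1 / 2 + c) (1 + b + c) with hf₂
  set f₄ : ℝ → ℝ := ₂F₁ (-1 / 2 - a) (1 / 2 + c) (1 + b + c) with hf₄
  set E : ℝ → ℝ := fun x => f₁ x * f₂ (1 - x) + f₃ x * f₄ (1 - x) - f₂ (1 - x) * f₃ x with hE
  have hconst : ∀ y ∈ Ioo (0 : ℝ) 1, E y = E x := fun y hy =>
    isOpen_Ioo.is_const_of_deriv_eq_zero isPreconnected_Ioo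
      (fun z hz => (hasDerivAt_elliott hab hbc hz).differentiableAt.differentiableWithinAt)
      (fun z hz => (hasDerivAt_elliott hab hbc hz).deriv) hy ⟨hx0, hx1⟩
  have h4 : Tendsto (fun y => f₄ (1 - y)) (𝓝[>] 0)
      (𝓝 (beta (1 / 2 + c) (1 / 2 + b - (-1 / 2 - a)) / beta (1 / 2 + c) (1 / 2 + b))) := by
    have := tendsto_ordinaryHypergeometric_one_sub (α := -1 / 2 - a) (by linarith) hβ hδ
    rwa [hγ] at this
  have h2 : Tendsto (fun y => y * f₂ (1 - y)) (𝓝[>] 0) (𝓝 0) := by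
    have := tendsto_mul_ordinaryHypergeometric_one_sub (α := 1 / 2 - a) (by linarith) hβ hδ
    rwa [hγ] at this
  have d1 : DifferentiableAt ℝ f₁ 0 :=
    differentiableAt_ordinaryHypergeometric _ _ hab (by simp)
  have d3 : DifferentiableAt ℝ f₃ 0 :=
    differentiableAt_ordinaryHypergeometric _ _ hab (by simp)
  have h3 : Tendsto f₃ (𝓝[>] 0) (𝓝 1) := by
    have := d3.continuousAt.tendsto.mono_left (nhdsWithin_le_nhds (s := Ioi 0))
    rwa [hf₃, ordinaryHypergeometric_zero] at this
  -- `F₁` and `F₃` agree at `0`, so `(F₁ - F₃) / x` has a finite limit; its value is irrelevant, as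
  -- it multiplies `x F₂ → 0`.
  have h13 := ((d1.sub d3).hasDerivAt.tendsto_slope).mono_left
    (nhdsWithin_mono 0 fun y (hy : 0 < y) => hy.ne')
  have hlim := (h2.mul h13).add (h3.mul h4)
  rw [zero_mul, zero_add, one_mul] at hlim
  have hE' : Tendsto (fun _ : ℝ => E x) (𝓝[>] 0)
      (𝓝 (beta (1 / 2 + c) (1 / 2 + b - (-1 / 2 - a)) / beta (1 / 2 + c) (1 / 2 + b))) := by
    refine hlim.congr' ?_
    filter_upwards [Ioo_mem_nhdsGT (zero_lt_one' ℝ)] with y hy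
    have hy0 : y ≠ 0 := hy.1.ne'
    rw [← hconst y hy, slope_def_field]
    simp only [hE, Pi.sub_apply, hf₁, hf₃, ordinaryHypergeometric_zero, sub_self, sub_zero]
    field_simp
    ring
  have := tendsto_nhds_unique tendsto_const_nhds hE'
  rw [hF₁, hF₂, hF₃, hF₄]
  change E x = _
  rw [this, beta, beta, show 1 / 2 + b - (-1 / 2 - a) = a + b + 1 by ring,
    show 1 / 2 + c + (a + b + 1) = a + b + c + 3 / 2 by ring,
    show 1 / 2 + c + (1 / 2 + b) = b + c + 1 by ring, add_comm (1 / 2) b]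
  have g1 := (Real.Gamma_pos_of_pos hβ).ne'
  have g2 := (Real.Gamma_pos_of_pos (show 0 < b + 1 / 2 by linarith)).ne'
  have g3 := (Real.Gamma_pos_of_pos (show 0 < b + c + 1 by linarith)).ne'
  have g4 := (Real.Gamma_pos_of_pos (show 0 < a + b + c + 3 / 2 by linarith)).ne'
  field_simp
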